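/- Let $d$ be a non-negative integer and $A=\mathbb C[z_1,\dots,z_d]$. A contractive Hilbert $A$-module is a complex Hilbert space $H$ that is also an $A$-module (compatibly with its complex vector space structure) such that $$\|z_1\xi_1+\cdots+z_d\xi_d\|^2\le\|\xi_1\|^2+\cdots+\|\xi_d\|^2\qquad\text{for all }\xi_1,\dots,\xi_d\in H.$$ Let $T_k\in\mathcal B(H)$ be the operator $T_k\xi=z_k\xi$, put $\phi(X)=\sum_{k=1}^d T_kXT_k^*$ for $X\in\mathcal B(H)$ and $\Delta=(\mathbf 1-\phi(\mathbf 1))^{1/2}$. Let $M_H=\operatorname{span}\{f\cdot\Delta\xi: f\in A,\ \xi\in H\}$ be the (not closed) $A$-submodule of $H$ generated by $\Delta H$. Assume that $H$ has finite rank, i.e. that $\Delta H$ is finite-dimensional. Then $M_H$ has a finite free resolution, that is, an exact sequence of $A$-modules $$0\to F_m\to\cdots\to F_2\to F_1\to M_H\to 0,\qquad F_k\cong A^{\beta_k},\ \beta_k<\infty;$$ the number $\chi(H)=\sum_{k=1}^m(-1)^{k+1}\beta_k$ (the Euler characteristic of $H$) is the same for every such resolution; the operator $\mathbf 1-\phi^{n+1}(\mathbf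 1)$ has finite rank for every $n\ge 0$; and $$\chi(H)=d!\,\lim_{n\to\infty}\frac{\operatorname{rank}\bigl(\mathbf 1-\phi^{n+1}(\mathbf 1)\bigr)}{n^d},$$ where the limit exists. -/

import Mathlib

open Filter Topology

noncomputable section

namespace Arveson

/-- The algebra `A = ℂ[z₁, …, z_d]`. -/
abbrev PolyAlg (d : ℕ) : Type := MvPolynomial (Fin d) ℂ

section FreeResolution

variable (R : Type*) [CommRing R] (M : Type*) [AddCommGroup M] [Module R M]

/-- A finite free resolution `0 → F_n → ⋯ → F_2 → F_1 → M → 0` of an `R`-module `M`.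
Here `F_{k+1} = R ^ betti k`, the modules beyond position `length` are zero, and exactness at
every place (including the injectivity of the leftmost map) is expressed by `exact`. -/
structure FiniteFreeResolution where
  length : ℕ
  betti : ℕ → ℕ
  betti_eq_zero : ∀ k, length ≤ k → betti k = 0
  augmentation : (Fin (betti 0) → R) →ₗ[R] M
  map : ∀ k, (Fin (betti (k + 1)) → R) →ₗ[R] (Fin (betti k) → R)
  surjective_augmentation : Function.Surjective augmentation
  exact_augmentation : Function.Exact (map 0) augmentation
  exact : ∀ k, Function.Exact (map (k + 1)) (map k)

variable {R M} in
/-- The alternating sum `rank F_1 - rank F_2 + rank F_3 - ⋯` of a finite free resolution. -/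
def FiniteFreeResolution.alternatingSum (F : FiniteFreeResolution R M) : ℤ :=
  ∑ k ∈ Finset.range F.length, (-1) ^ k * (F.betti k : ℤ)

open scoped Classical in
/-- The Euler characteristic of a module: the alternating sum of the ranks in a finite free
resolution (the value `0` is used if there is none). -/
def moduleEulerChar : ℤ :=
  if h : Nonempty (FiniteFreeResolution R M) then h.some.alternatingSum else 0

end FreeResolution

section HilbertModule

variable (d : ℕ) (H : Type*) [NormedAddCommGroup H] [Module (PolyAlg d) H]

/-- A module over `ℂ[z₁, …, z_d]` on a Hilbert space is contractive if
`‖z₁ξ₁ + ⋯ + z_dξ_d‖² ≤ ‖ξ₁‖² + ⋯ + ‖ξ_d‖²` for all vectors `ξ₁, …, ξ_d`. -/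
def IsContractive : Prop :=
  ∀ ξ : Fin d → H, ‖∑ k, (MvPolynomial.X k : PolyAlg d) • ξ k‖ ^ 2 ≤ ∑ k, ‖ξ k‖ ^ 2

variable {d H}

theorem IsContractive.norm_X_smul_le (hH : IsContractive d H) (k : Fin d) (ξ : H) :
    ‖(MvPolynomial.X k : PolyAlg d) • ξ‖ ≤ ‖ξ‖ := by
  classical
  have h := hH (fun j => if j = k then ξ else 0)
  have h1 : ∑ j, (MvPolynomial.X j : PolyAlg d) • (if j = k then ξ else 0)
      = (MvPolynomial.X k : PolyAlg d) • ξ := by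
    rw [Finset.sum_eq_single k]
    · simp
    · intro j _ hj
      simp [hj]
    · simp
  have h2 : ∑ j, ‖(if j = k then ξ else 0 : H)‖ ^ 2 = ‖ξ‖ ^ 2 := by
    rw [Finset.sum_eq_single k]
    · simp
    · intro j _ hj
      simp [hj]
    · simp
  rw [h1, h2] at h
  exact le_of_sq_le_sq h (norm_nonneg _)

variable [InnerProductSpace ℂ H] [IsScalarTower ℂ (PolyAlg d) H]

/-- The operator `T_k ξ = z_k • ξ` of a contractive Hilbert module, as a bounded operator. -/
def coordOp (hH : IsContractive d H) (k : Fin d) : H →L[ℂ] H :=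
  LinearMap.mkContinuous (Algebra.lsmul ℂ ℂ H (MvPolynomial.X k : PolyAlg d)) 1
    (fun ξ => by simpa using hH.norm_X_smul_le k ξ)

variable [CompleteSpace H]

/-- The map `φ(X) = T₁ X T₁* + ⋯ + T_d X T_d*` on `B(H)`. -/
def phi (hH : IsContractive d H) (X : H →L[ℂ] H) : H →L[ℂ] H :=
  ∑ k, coordOp hH k * X * ContinuousLinearMap.adjoint (coordOp hH k)

/-- The defect operator `Δ = (1 - T₁T₁* - ⋯ - T_dT_d*)^{1/2}`. -/
def defect (hH : IsContractive d H) : H →L[ℂ] H :=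
  CFC.sqrt (1 - ∑ k, coordOp hH k * ContinuousLinearMap.adjoint (coordOp hH k))

/-- A bounded operator has finite rank if its range is finite-dimensional. -/
def IsFiniteRankOp (X : H →L[ℂ] H) : Prop :=
  FiniteDimensional ℂ (LinearMap.range (X : H →ₗ[ℂ] H))

/-- The rank of a bounded operator of finite rank. -/
def opRank (X : H →L[ℂ] H) : ℕ :=
  Module.finrank ℂ (LinearMap.range (X : H →ₗ[ℂ] H))

/-- A contractive Hilbert module has finite rank if the range of `Δ` is finite-dimensional. -/
def HasFiniteRank (hH : IsContractive d H) : Prop :=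
  IsFiniteRankOp (defect hH)

/-- The (unclosed) submodule `M_H = span {f • ξ : f ∈ A, ξ ∈ Δ H}`. -/
def algModule (hH : IsContractive d H) : Submodule (PolyAlg d) H :=
  Submodule.span (PolyAlg d) (Set.range (defect hH))

/-- The Euler characteristic `χ(H)`. -/
def eulerChar (hH : IsContractive d H) : ℤ :=
  moduleEulerChar (PolyAlg d) (algModule hH)

end HilbertModule

end Arveson

end

-- Both sides of the limit formula equal the rank of the module $M_H$ over the domain $A$.
--
-- Algebra: rank is additive over a domain, so the alternating sum of any finite free resolution
-- telescopes to the rank (`alternatingSum_eq_finrank`); existence of a resolution is Hilbert's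
-- syzygy theorem (`FiniteModulesHaveFreeResolutions.mvPolynomial`). That theorem is proved by
-- adjoining one variable at a time: if $M_n$ is the image in $M$ of vectors over $R[X]$ of degree
-- $<n$, then for large $n$ the sequence $0\to R[X]\otimes M_n\to R[X]\otimes M_{n+1}\to M\to 0$ is
-- exact, and the two left terms are resolved by base change from $R$.
--
-- Analysis: $1-\phi^{n+1}(1)=\Delta^2+\phi(1-\phi^n(1))$ is a sum of positive operators, so its
-- kernel is an intersection of kernels. Taking orthogonal complements, its range is exactly the
-- span of $f\Delta\xi$ with $\deg f\le n$ (`range_one_sub_iterate_phi`). The rank in the theorem is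
-- thus a Hilbert function of $M_H$.
--
-- Link: if $M=A^g/K$ has rank $\rho$ and $K$ has rank $\kappa=g-\rho$, a free submodule of rank
-- $\rho$ in $M$ bounds the Hilbert function below, and one of rank $\kappa$ in $K$ bounds it above.
-- Both bounds are asymptotic to $\rho\,n^d/d!$ (`tendsto_factorial_mul_finrank_map_div_pow`).

universe u v

/-! ### Finite free resolutions and short exact sequences -/

/-- `HasFreeResolution R n M`: the module `M` has a resolution of length at most `n` by
finite free modules. -/
def HasFreeResolution (R : Type u) [CommRing R] :
    ℕ → ∀ (M : Type u) [AddCommGroup M] [Module R M], Prop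
  | 0, M, _, _ => Subsingleton M
  | n + 1, M, _, _ => ∃ (b : ℕ) (f : (Fin b → R) →ₗ[R] M),
      Function.Surjective f ∧ HasFreeResolution R n (LinearMap.ker f)

namespace HasFreeResolution

variable {R : Type u} [CommRing R] {n : ℕ}

theorem of_linearEquiv {M N : Type u} [AddCommGroup M] [Module R M] [AddCommGroup N] [Module R N]
    (e : M ≃ₗ[R] N) (h : HasFreeResolution R n M) : HasFreeResolution R n N := by
  cases n with
  | zero => exact (e.toEquiv.subsingleton_congr).1 h
  | succ n =>
    obtain ⟨b, f, hf, h⟩ := h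
    refine ⟨b, e.toLinearMap ∘ₗ f, e.surjective.comp hf, ?_⟩
    rwa [LinearEquiv.ker_comp]

theorem of_subsingleton {M : Type u} [AddCommGroup M] [Module R M] [Subsingleton M] (n : ℕ) :
    HasFreeResolution R n M := by
  induction n generalizing M with
  | zero => assumption
  | succ n ih => exact ⟨0, 0, fun x => ⟨0, Subsingleton.elim _ _⟩, ih⟩

theorem succ {M : Type u} [AddCommGroup M] [Module R M]
    (h : HasFreeResolution R n M) : HasFreeResolution R (n + 1) M := by
  induction n generalizing M with
  | zero => exact @of_subsingleton R _ M _ _ h 1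
  | succ n ih =>
    obtain ⟨b, f, hf, h⟩ := h
    exact ⟨b, f, hf, ih h⟩

theorem mono {M : Type u} [AddCommGroup M] [Module R M] {m : ℕ} (hnm : n ≤ m)
    (h : HasFreeResolution R n M) : HasFreeResolution R m M :=
  Nat.le_induction h (fun _ _ h => h.succ) m hnm

theorem succ_of_exact {K F M : Type u} [AddCommGroup K] [Module R K] [AddCommGroup F] [Module R F]
    [AddCommGroup M] [Module R M] [Module.Free R F] [Module.Finite R F]
    (i : K →ₗ[R] F) (f : F →ₗ[R] M) (hi : Function.Injective i) (hex : Function.Exact i f)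
    (hf : Function.Surjective f) (hK : HasFreeResolution R n K) :
    HasFreeResolution R (n + 1) M := by
  classical
  -- A basis indexed by the rank needs a nontrivial ring; over the zero ring every module vanishes.
  rcases subsingleton_or_nontrivial R with hR | hR
  · have := Module.subsingleton R M
    exact of_subsingleton _
  let e := (Module.finBasis R F).equivFun
  refine ⟨_, f ∘ₗ e.symm.toLinearMap, hf.comp e.symm.surjective, ?_⟩
  have h1 : LinearMap.range (e.toLinearMap ∘ₗ i) = LinearMap.ker (f ∘ₗ e.symm.toLinearMap) := by
    ext x
    rw [LinearMap.mem_range, LinearMap.mem_ker, LinearMap.comp_apply, LinearEquiv.coe_coe, hex]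
    constructor
    · rintro ⟨y, rfl⟩; exact ⟨y, by simp⟩
    · rintro ⟨y, hy⟩; exact ⟨y, by simp [hy]⟩
  exact hK.of_linearEquiv
    ((LinearEquiv.ofInjective (e.toLinearMap ∘ₗ i) (e.injective.comp hi)).trans (LinearEquiv.ofEq _ _ h1))

theorem of_free (F : Type u) [AddCommGroup F] [Module R F] [Module.Free R F] [Module.Finite R F] :
    HasFreeResolution R 1 F :=
  succ_of_exact (K := PUnit.{u + 1}) (0 : PUnit.{u + 1} →ₗ[R] F) LinearMap.id
    (fun _ _ _ => Subsingleton.elim _ _)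
    (fun x => by simp [eq_comm]) Function.surjective_id (of_subsingleton 0)

/-- The horseshoe lemma. -/
theorem of_extension {A B C : Type u} [AddCommGroup A] [Module R A] [AddCommGroup B] [Module R B]
    [AddCommGroup C] [Module R C] (i : A →ₗ[R] B) (p : B →ₗ[R] C) (hi : Function.Injective i)
    (hex : Function.Exact i p) (hp : Function.Surjective p)
    (hA : HasFreeResolution R n A) (hC : HasFreeResolution R n C) :
    HasFreeResolution R n B := by
  induction n generalizing A B C with
  | zero =>
    have : Subsingleton A := hA
    have : Subsingleton C := hC
    refine ⟨fun x y => ?_⟩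
    have h0 : ∀ z : B, z = 0 := fun z => by
      obtain ⟨a, rfl⟩ := (hex z).1 (Subsingleton.elim _ _)
      rw [Subsingleton.elim a 0, map_zero]
    rw [h0 x, h0 y]
  | succ n ih =>
    obtain ⟨a, f, hf, hA⟩ := hA
    obtain ⟨c, g, hg, hC⟩ := hC
    -- Lifting the cover of `C` through `p` gives a free cover `q` of `B`; the kernels of the three
    -- covers again form a short exact sequence, to which the induction hypothesis applies.
    obtain ⟨g', hg'⟩ := Module.projective_lifting_property p g hp
    have hg'x : ∀ x, p (g' x) = g x := fun x => DFunLike.congr_fun hg' x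
    have hpi : ∀ x, p (i x) = 0 := fun x => (hex _).2 ⟨x, rfl⟩
    let q : ((Fin a → R) × (Fin c → R)) →ₗ[R] B := (i ∘ₗ f).coprod g'
    have hq : ∀ x, q x = i (f x.1) + g' x.2 := fun x => rfl
    have hqs : Function.Surjective q := fun b => by
      obtain ⟨y, hy⟩ := hg (p b)
      obtain ⟨x', hx'⟩ := (hex (b - g' y)).1 (by rw [map_sub, hg'x, hy, sub_self])
      obtain ⟨x, rfl⟩ := hf x'
      exact ⟨(x, y), by rw [hq, hx', sub_add_cancel]⟩
    refine succ_of_exact (LinearMap.ker q).subtype q Subtype.val_injective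
      (LinearMap.exact_subtype_ker_map q) hqs ?_
    let j : LinearMap.ker f →ₗ[R] LinearMap.ker q :=
      LinearMap.codRestrict _ (LinearMap.inl R _ _ ∘ₗ (LinearMap.ker f).subtype)
        (fun x => by simp [hq, LinearMap.mem_ker])
    have hj : ∀ x, (j x : (Fin a → R) × (Fin c → R)) = (x.1, 0) := fun x => rfl
    let r : LinearMap.ker q →ₗ[R] LinearMap.ker g :=
      LinearMap.codRestrict _ (LinearMap.snd R _ _ ∘ₗ (LinearMap.ker q).subtype)
        (fun x => by
          have h1 := congrArg p (LinearMap.mem_ker.1 x.2)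
          rw [hq, map_add, hpi, zero_add, hg'x, map_zero] at h1
          exact h1)
    have hr : ∀ x, (r x : Fin c → R) = x.1.2 := fun x => rfl
    refine ih j r (fun x y hxy => ?_) (fun x => ?_) (fun y => ?_) hA hC
    · have := congrArg Subtype.val hxy
      rw [hj, hj] at this
      exact Subtype.ext (congrArg Prod.fst this)
    · constructor
      · intro hx
        have hx2 : x.1.2 = 0 := by rw [← hr, hx]; rfl
        have hx1 := LinearMap.mem_ker.1 x.2
        rw [hq, hx2, map_zero, add_zero] at hx1
        refine ⟨⟨x.1.1, LinearMap.mem_ker.2 (hi (by rw [hx1, map_zero]))⟩, Subtype.ext ?_⟩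
        rw [hj, ← hx2]
      · rintro ⟨y, rfl⟩
        exact Subtype.ext (by rw [hr, hj]; rfl)
    · obtain ⟨z, hz⟩ := (hex (g' y.1)).1 (by rw [hg'x]; exact y.2)
      obtain ⟨x, rfl⟩ := hf z
      refine ⟨⟨(-x, y.1), ?_⟩, Subtype.ext ?_⟩
      · rw [LinearMap.mem_ker, hq, map_neg, map_neg, hz, neg_add_cancel]
      · rw [hr]

/-- The quotient of modules with finite free resolutions has one. -/
theorem of_quotient {A B C : Type u} [AddCommGroup A] [Module R A] [AddCommGroup B] [Module R B]
    [AddCommGroup C] [Module R C] (i : A →ₗ[R] B) (p : B →ₗ[R] C) (hi : Function.Injective i)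
    (hex : Function.Exact i p) (hp : Function.Surjective p)
    (hA : HasFreeResolution R n A) (hB : HasFreeResolution R (n + 1) B) :
    HasFreeResolution R (n + 1) C := by
  obtain ⟨b, f, hf, hB⟩ := hB
  refine ⟨b, p ∘ₗ f, hp.comp hf, ?_⟩
  have hpi : ∀ x, p (i x) = 0 := fun x => (hex _).2 ⟨x, rfl⟩
  let e := LinearEquiv.ofInjective i hi
  have he : ∀ x, i (e.symm x) = x.1 := fun x => congrArg Subtype.val (e.apply_symm_apply x)
  -- The kernel of the composite cover `p ∘ f` is an extension of `A` by `ker f`, so the horseshoe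
  -- lemma resolves it.
  let j : LinearMap.ker f →ₗ[R] LinearMap.ker (p ∘ₗ f) :=
    Submodule.inclusion (fun x hx => by
      rw [LinearMap.mem_ker] at hx ⊢
      rw [LinearMap.comp_apply, hx, map_zero])
  let r : LinearMap.ker (p ∘ₗ f) →ₗ[R] A := e.symm.toLinearMap ∘ₗ
    LinearMap.codRestrict (LinearMap.range i) (f ∘ₗ (LinearMap.ker (p ∘ₗ f)).subtype)
      (fun x => (hex _).1 x.2)
  have hr : ∀ x, i (r x) = f x.1 := fun x => he _
  refine of_extension j r (Submodule.inclusion_injective _) (fun x => ?_) (fun y => ?_) hB hA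
  · constructor
    · intro hx
      exact ⟨⟨x.1, by rw [LinearMap.mem_ker, ← hr, hx, map_zero]⟩, rfl⟩
    · rintro ⟨y, rfl⟩
      exact hi (by rw [hr, map_zero]; exact y.2)
  · obtain ⟨x, hx⟩ := hf (i y)
    refine ⟨⟨x, ?_⟩, hi ?_⟩
    · rw [LinearMap.mem_ker, LinearMap.comp_apply, hx, hpi]
    · rw [hr, hx]

end HasFreeResolution

/-! ### Explicit resolutions and their alternating sums -/

namespace Arveson.FiniteFreeResolution

variable {R : Type u} [CommRing R]

/-- Splice a surjection from a finite free module with a resolution of its kernel. -/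
def splice {M : Type v} [AddCommGroup M] [Module R M] {b : ℕ} (f : (Fin b → R) →ₗ[R] M)
    (hf : Function.Surjective f) (F : FiniteFreeResolution R (LinearMap.ker f)) :
    FiniteFreeResolution R M where
  length := F.length + 1
  betti
    | 0 => b
    | k + 1 => F.betti k
  betti_eq_zero
    | 0 => fun h => absurd h (by omega)
    | k + 1 => fun h => F.betti_eq_zero k (by omega)
  augmentation := f
  map
    | 0 => (LinearMap.ker f).subtype ∘ₗ F.augmentation
    | k + 1 => F.map k
  surjective_augmentation := hf
  exact_augmentation := fun x => by
    constructor
    · intro hx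
      obtain ⟨y, hy⟩ := F.surjective_augmentation ⟨x, hx⟩
      exact ⟨y, congrArg Subtype.val hy⟩
    · rintro ⟨y, rfl⟩
      exact (F.augmentation y).2
  exact
    | 0 => fun x => by
      rw [← F.exact_augmentation x]
      exact Submodule.coe_eq_zero
    | k + 1 => F.exact k

/-- The trivial resolution of the zero module. -/
def ofSubsingleton (M : Type v) [AddCommGroup M] [Module R M] [Subsingleton M] :
    FiniteFreeResolution R M where
  length := 0
  betti _ := 0
  betti_eq_zero _ _ := rfl
  augmentation := 0
  map _ := 0
  surjective_augmentation _ := ⟨0, Subsingleton.elim _ _⟩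
  exact_augmentation _ := ⟨fun _ => ⟨0, Subsingleton.elim _ _⟩, fun _ => rfl⟩
  exact _ _ := ⟨fun _ => ⟨0, Subsingleton.elim _ _⟩, fun _ => rfl⟩

theorem _root_.HasFreeResolution.nonempty {n : ℕ} {M : Type u} [AddCommGroup M] [Module R M]
    (h : HasFreeResolution R n M) : Nonempty (FiniteFreeResolution R M) := by
  induction n generalizing M with
  | zero => exact ⟨@ofSubsingleton R _ M _ _ h⟩
  | succ n ih =>
    obtain ⟨b, f, hf, h⟩ := h
    exact (ih h).map (splice f hf)

/-- Transport a resolution along an isomorphism of modules. -/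
def ofLinearEquiv {M : Type u} {N : Type v} [AddCommGroup M] [Module R M] [AddCommGroup N]
    [Module R N] (e : M ≃ₗ[R] N) (F : FiniteFreeResolution R M) : FiniteFreeResolution R N where
  __ := F
  augmentation := e.toLinearMap ∘ₗ F.augmentation
  surjective_augmentation := e.surjective.comp F.surjective_augmentation
  exact_augmentation := fun x => by
    rw [← F.exact_augmentation x]
    exact e.map_eq_zero_iff

theorem natCast_eq_finrank_range_add_finrank_ker [IsDomain R] {M : Type v} [AddCommGroup M]
    [Module R M] {a : ℕ} (f : (Fin a → R) →ₗ[R] M) :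
    (a : ℤ) = Module.finrank R (LinearMap.range f) + Module.finrank R (LinearMap.ker f) := by
  rw [← f.quotKerEquivRange.finrank_eq, ← Nat.cast_add, Submodule.finrank_quotient_add_finrank,
    Module.finrank_fin_fun]

/-- Each Betti number splits as the sum of the ranks of two consecutive images, so partial sums
telescope. In particular the value does not depend on the resolution. -/
theorem alternatingSum_eq_finrank [IsDomain R] {M : Type v} [AddCommGroup M] [Module R M]
    (F : FiniteFreeResolution R M) : F.alternatingSum = Module.finrank R M := by
  have hfin : Module.Finite R M := Module.Finite.of_surjective _ F.surjective_augmentation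
  have h0 : (F.betti 0 : ℤ) =
      Module.finrank R M + Module.finrank R (LinearMap.range (F.map 0)) := by
    rw [natCast_eq_finrank_range_add_finrank_ker F.augmentation, LinearMap.range_eq_top.2 F.surjective_augmentation,
      finrank_top, LinearMap.exact_iff.1 F.exact_augmentation]
  have h1 : ∀ k, (F.betti (k + 1) : ℤ) = Module.finrank R (LinearMap.range (F.map k)) +
      Module.finrank R (LinearMap.range (F.map (k + 1))) := fun k => by
    rw [natCast_eq_finrank_range_add_finrank_ker (F.map k), LinearMap.exact_iff.1 (F.exact k)]
  have key : ∀ N, ∑ k ∈ Finset.range (N + 1), (-1 : ℤ) ^ k * (F.betti k : ℤ) =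
      Module.finrank R M + (-1) ^ N * Module.finrank R (LinearMap.range (F.map N)) := by
    intro N
    induction N with
    | zero => simp [h0]
    | succ N ih => rw [Finset.sum_range_succ, ih, h1, pow_succ]; ring
  have hL := key F.length
  have hb : (F.betti F.length : ℤ) = 0 := by rw [F.betti_eq_zero _ le_rfl, Nat.cast_zero]
  rw [Finset.sum_range_succ, hb] at hL
  -- The next Betti number also vanishes, and this rank is one of its two nonnegative summands.
  have hz : Module.finrank R (LinearMap.range (F.map F.length)) = 0 := by
    have h2 := h1 F.length
    have h3 := F.betti_eq_zero _ (Nat.le_add_right F.length 1)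
    omega
  rw [hz] at hL
  simpa [alternatingSum] using hL

end Arveson.FiniteFreeResolution

/-! ### Hilbert's syzygy theorem: change of rings and coefficients in `R[X] ⊗ M` -/

section

open scoped TensorProduct Polynomial

namespace HasFreeResolution

theorem baseChange {R : Type u} [CommRing R] (S : Type u) [CommRing S] [Algebra R S]
    [Module.Flat R S] {n : ℕ} {M : Type u} [AddCommGroup M] [Module R M]
    (h : HasFreeResolution R n M) : HasFreeResolution S n (S ⊗[R] M) := by
  induction n generalizing M with
  | zero =>
    have : Subsingleton M := h
    exact of_subsingleton 0
  | succ n ih =>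
    obtain ⟨b, f, hf, h⟩ := h
    exact succ_of_exact ((LinearMap.ker f).subtype.baseChange S) (f.baseChange S)
      (Module.Flat.lTensor_preserves_injective_linearMap _ Subtype.val_injective)
      (Module.Flat.lTensor_exact S (LinearMap.exact_subtype_ker_map f))
      (LinearMap.lTensor_surjective S hf) (ih h)

theorem of_semilinearEquiv {R R' : Type u} [CommRing R] [CommRing R'] (e : R ≃+* R') {n : ℕ}
    {M M' : Type u} [AddCommGroup M] [Module R M] [AddCommGroup M'] [Module R' M']
    (ψ : M ≃+ M') (hψ : ∀ (r : R) (m : M), ψ (r • m) = e r • ψ m)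
    (h : HasFreeResolution R n M) : HasFreeResolution R' n M' := by
  induction n generalizing M M' with
  | zero =>
    have : Subsingleton M := h
    exact ψ.symm.injective.subsingleton
  | succ n ih =>
    obtain ⟨b, f, hf, h⟩ := h
    let f' : (Fin b → R') →ₗ[R'] M' :=
      { toFun := fun x => ψ (f fun i => e.symm (x i))
        map_add' := fun x y => by
          rw [← map_add, ← map_add]
          congr 2
          funext i
          simp
        map_smul' := fun r x => by
          have : (fun i => e.symm ((r • x) i)) = e.symm r • fun i => e.symm (x i) := by
            funext i
            simp
          rw [this, map_smul, hψ, e.apply_symm_apply, RingHom.id_apply] }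
    have hf' : ∀ x, f' x = ψ (f fun i => e.symm (x i)) := fun x => rfl
    refine ⟨b, f', fun y => ?_, ?_⟩
    · obtain ⟨x, hx⟩ := hf (ψ.symm y)
      exact ⟨fun i => e (x i), by simp [hf', hx]⟩
    · let χ : LinearMap.ker f ≃+ LinearMap.ker f' :=
        { toFun := fun x => ⟨fun i => e (x.1 i), by simp [hf']⟩
          invFun := fun x => ⟨fun i => e.symm (x.1 i), by
            have := x.2
            rwa [LinearMap.mem_ker, hf', map_eq_zero_iff ψ ψ.injective] at this⟩
          left_inv := fun x => by simp
          right_inv := fun x => by simp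
          map_add' := fun x y => Subtype.ext (funext fun i => by simp) }
      exact ih χ (fun r m => Subtype.ext (funext fun i => by simp [χ])) h

end HasFreeResolution

/-- Every finitely generated module has a resolution of finite length by finite free modules. -/
def FiniteModulesHaveFreeResolutions (R : Type u) [CommRing R] : Prop :=
  ∀ (M : Type u) [AddCommGroup M] [Module R M] [Module.Finite R M], ∃ n, HasFreeResolution R n M

theorem FiniteModulesHaveFreeResolutions.of_ringEquiv {R R' : Type u} [CommRing R] [CommRing R']
    (e : R ≃+* R') (h : FiniteModulesHaveFreeResolutions R) :
    FiniteModulesHaveFreeResolutions R' := by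
  intro M _ _ hM
  let : Module R M := Module.compHom M (e : R →+* R')
  have hs : ∀ (r : R) (m : M), r • m = e r • m := fun _ _ => rfl
  have : Module.Finite R M := by
    obtain ⟨s, hs'⟩ := hM.fg_top
    refine ⟨⟨s, eq_top_iff.2 fun x _ => ?_⟩⟩
    have hx : x ∈ Submodule.span R' (s : Set M) := hs' ▸ Submodule.mem_top
    induction hx using Submodule.span_induction with
    | mem x hx => exact Submodule.subset_span hx
    | zero => exact zero_mem _
    | add x y _ _ hx hy => exact add_mem (hx trivial) (hy trivial)
    | smul r x _ hx =>
      have := Submodule.smul_mem _ (e.symm r) (hx trivial)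
      rwa [hs, e.apply_symm_apply] at this
  obtain ⟨n, hn⟩ := h M
  exact ⟨n, hn.of_semilinearEquiv e (AddEquiv.refl M) hs⟩

theorem FiniteModulesHaveFreeResolutions.of_field (k : Type u) [Field k] :
    FiniteModulesHaveFreeResolutions k :=
  fun M _ _ _ => ⟨1, HasFreeResolution.of_free M⟩

namespace Polynomial

variable {R : Type u} [CommRing R]

section Coefficients

variable {M : Type v} [AddCommGroup M] [Module R M]

variable (R M) in
/-- The `i`-th coefficient of an element of `R[X] ⊗ M`. -/
noncomputable def tensorCoeff (i : ℕ) : R[X] ⊗[R] M →ₗ[R] M :=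
  (TensorProduct.lid R M).toLinearMap ∘ₗ (lcoeff R i).rTensor M

theorem tensorCoeff_tmul (i : ℕ) (s : R[X]) (m : M) :
    tensorCoeff R M i (s ⊗ₜ m) = s.coeff i • m := by
  simp [tensorCoeff]

theorem exists_tensorCoeff_eq_zero (t : R[X] ⊗[R] M) :
    ∃ N, ∀ i, N ≤ i → tensorCoeff R M i t = 0 := by
  induction t using TensorProduct.induction_on with
  | zero => exact ⟨0, fun i _ => map_zero _⟩
  | tmul s m =>
    refine ⟨s.natDegree + 1, fun i hi => ?_⟩
    rw [tensorCoeff_tmul, coeff_eq_zero_of_natDegree_lt (by omega), zero_smul]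
  | add x y hx hy =>
    obtain ⟨N, hN⟩ := hx
    obtain ⟨N', hN'⟩ := hy
    exact ⟨max N N', fun i hi => by
      rw [map_add, hN i (by omega), hN' i (by omega), add_zero]⟩

/-- Asking for every large `N'` lets the expansions of two summands be brought to a common length.
-/
theorem exists_eq_sum_tensorCoeff (t : R[X] ⊗[R] M) :
    ∃ N, ∀ N', N ≤ N' →
      t = ∑ i ∈ Finset.range N', (X ^ i : R[X]) ⊗ₜ[R] tensorCoeff R M i t := by
  induction t using TensorProduct.induction_on with
  | zero => exact ⟨0, fun i _ => by simp⟩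
  | tmul s m =>
    refine ⟨s.natDegree + 1, fun N' hN' => ?_⟩
    conv_lhs => rw [s.as_sum_range' N' (by omega), TensorProduct.sum_tmul]
    refine Finset.sum_congr rfl fun i _ => ?_
    rw [tensorCoeff_tmul, ← TensorProduct.smul_tmul, smul_X_eq_monomial]
  | add x y hx hy =>
    obtain ⟨N, hN⟩ := hx
    obtain ⟨N', hN'⟩ := hy
    refine ⟨max N N', fun i hi => ?_⟩
    conv_lhs => rw [hN i (by omega), hN' i (by omega)]
    simp [TensorProduct.tmul_add, Finset.sum_add_distrib]

theorem eq_zero_of_tensorCoeff_eq_zero {t : R[X] ⊗[R] M} (h : ∀ i, tensorCoeff R M i t = 0) :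
    t = 0 := by
  obtain ⟨N, hN⟩ := exists_eq_sum_tensorCoeff t
  rw [hN N le_rfl]
  exact Finset.sum_eq_zero fun i _ => by rw [h, TensorProduct.tmul_zero]

end Coefficients

section Characteristic

variable {U V : Type v} [AddCommGroup U] [Module R U] [AddCommGroup V] [Module R V]

/-- The map `s ⊗ u ↦ sX ⊗ ι u - s ⊗ μ u`. -/
noncomputable def charMap (ι μ : U →ₗ[R] V) : R[X] ⊗[R] U →ₗ[R[X]] R[X] ⊗[R] V :=
  (X : R[X]) • ι.baseChange R[X] - μ.baseChange R[X]

theorem charMap_tmul (ι μ : U →ₗ[R] V) (s : R[X]) (u : U) :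
    charMap ι μ (s ⊗ₜ u) = (X * s) ⊗ₜ ι u - s ⊗ₜ μ u := by
  simp [charMap, TensorProduct.smul_tmul']

theorem tensorCoeff_succ_charMap (ι μ : U →ₗ[R] V) (i : ℕ) (t : R[X] ⊗[R] U) :
    tensorCoeff R V (i + 1) (charMap ι μ t) =
      ι (tensorCoeff R U i t) - μ (tensorCoeff R U (i + 1) t) := by
  induction t using TensorProduct.induction_on with
  | zero => simp
  | tmul s m => simp [charMap_tmul, tensorCoeff_tmul]
  | add x y hx hy => simp only [map_add, hx, hy]; abel

/-- On the kernel, coefficients satisfy $\iota(t_i)=\mu(t_{i+1})$. They vanish for large $i$, so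
injectivity of $\iota$ propagates the vanishing downwards. -/
theorem charMap_injective (ι μ : U →ₗ[R] V) (hι : Function.Injective ι) :
    Function.Injective (charMap ι μ) := by
  rw [injective_iff_map_eq_zero]
  intro t ht
  obtain ⟨N, hN⟩ := exists_tensorCoeff_eq_zero t
  have key : ∀ k i, N ≤ i + k → tensorCoeff R U i t = 0 := by
    intro k
    induction k with
    | zero => exact fun i hi => hN i hi
    | succ k ih =>
      intro i hi
      have h1 := tensorCoeff_succ_charMap ι μ i t
      rw [ht, ih (i + 1) (by omega), map_zero, map_zero, sub_zero] at h1
      exact hι (by rw [← h1, map_zero])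
  exact eq_zero_of_tensorCoeff_eq_zero fun i => key N i (by omega)

end Characteristic

section Presentation

variable (R) in
/-- Vectors of polynomials whose entries have degree less than `n`. -/
noncomputable def vectorsDegreeLT (g n : ℕ) : Submodule R (Fin g → R[X]) :=
  Submodule.span R ((fun p : Fin n × Fin g => Pi.single p.2 (X ^ (p.1 : ℕ))) '' Set.univ)

theorem single_X_pow_mem_vectorsDegreeLT {g n i : ℕ} (hi : i < n) (j : Fin g) :
    (Pi.single j (X ^ i) : Fin g → R[X]) ∈ vectorsDegreeLT R g n :=
  Submodule.subset_span ⟨(⟨i, hi⟩, j), trivial, rfl⟩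

theorem vectorsDegreeLT_fg (g n : ℕ) : (vectorsDegreeLT R g n).FG :=
  Submodule.fg_span (Set.finite_univ.image _)

theorem vectorsDegreeLT_mono (g : ℕ) : Monotone (vectorsDegreeLT R g) := by
  intro n m hnm
  refine Submodule.span_le.2 ?_
  rintro _ ⟨p, -, rfl⟩
  exact single_X_pow_mem_vectorsDegreeLT (by omega) _

theorem X_smul_mem_vectorsDegreeLT {g n : ℕ} {v : Fin g → R[X]} (hv : v ∈ vectorsDegreeLT R g n) :
    (X : R[X]) • v ∈ vectorsDegreeLT R g (n + 1) := by
  induction hv using Submodule.span_induction with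
  | mem x hx =>
    obtain ⟨p, -, rfl⟩ := hx
    have : (X : R[X]) • (Pi.single p.2 (X ^ (p.1 : ℕ)) : Fin g → R[X]) =
        Pi.single p.2 (X ^ ((p.1 : ℕ) + 1)) := by
      rw [← Pi.single_smul, smul_eq_mul, pow_succ']
    rw [this]
    exact single_X_pow_mem_vectorsDegreeLT (by omega) _
  | zero => simp
  | add x y _ _ hx hy => rw [smul_add]; exact add_mem hx hy
  | smul r x _ hx => rw [smul_comm]; exact Submodule.smul_mem _ _ hx

theorem exists_mem_vectorsDegreeLT {g : ℕ} (v : Fin g → R[X]) :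
    ∃ n, v ∈ vectorsDegreeLT R g n := by
  obtain ⟨D, hD⟩ : ∃ D, ∀ j, (v j).natDegree ≤ D :=
    ⟨_, fun j => Finset.le_sup (f := fun j => (v j).natDegree) (Finset.mem_univ j)⟩
  refine ⟨D + 1, ?_⟩
  rw [← Finset.univ_sum_single v]
  refine sum_mem fun j _ => ?_
  have : (Pi.single j (v j) : Fin g → R[X]) = ∑ i ∈ Finset.range ((v j).natDegree + 1),
      (v j).coeff i • (Pi.single j (X ^ i) : Fin g → R[X]) := by
    conv_lhs => rw [(v j).as_sum_range]
    rw [← LinearMap.single_apply (R := R), map_sum]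
    refine Finset.sum_congr rfl fun i _ => ?_
    rw [← smul_X_eq_monomial, map_smul, LinearMap.single_apply]
  rw [this]
  refine sum_mem fun i hi => Submodule.smul_mem _ _ (single_X_pow_mem_vectorsDegreeLT ?_ _)
  have := Finset.mem_range.1 hi
  have := hD j
  omega

theorem exists_generators_mem_vectorsDegreeLT {g : ℕ} (s : Finset (Fin g → R[X])) :
    ∃ n, ∀ v ∈ s, v ∈ vectorsDegreeLT R g n := by
  choose f hf using fun v : Fin g → R[X] => exists_mem_vectorsDegreeLT v
  exact ⟨s.sup f, fun v hv => vectorsDegreeLT_mono g (Finset.le_sup hv) (hf v)⟩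

end Presentation

end Polynomial

end

/-! ### Hilbert's syzygy theorem: the inductive step -/

section

open scoped TensorProduct Polynomial

namespace Polynomial

variable {R : Type u} [CommRing R] {g : ℕ} {M : Type v} [AddCommGroup M]
  [Module R[X] M] [Module R M] [IsScalarTower R R[X] M] (π : (Fin g → R[X]) →ₗ[R[X]] M)

/-- The image in `M` of the vectors whose entries have degree less than `n`. -/
noncomputable def imageDegreeLT (n : ℕ) : Submodule R M :=
  (vectorsDegreeLT R g n).map (π.restrictScalars R)

theorem imageDegreeLT_le (n : ℕ) : imageDegreeLT π n ≤ imageDegreeLT π (n + 1) :=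
  Submodule.map_mono (vectorsDegreeLT_mono g n.le_succ)

/-- Multiplication by `X` from `imageDegreeLT π n` to `imageDegreeLT π (n + 1)`. -/
noncomputable def imageMulX (n : ℕ) : imageDegreeLT π n →ₗ[R] imageDegreeLT π (n + 1) :=
  LinearMap.restrict (Algebra.lsmul R R M (X : R[X])) (by
    rintro _ ⟨v, hv, rfl⟩
    exact ⟨_, X_smul_mem_vectorsDegreeLT hv, by simp⟩)

theorem coe_imageMulX (n : ℕ) (m : imageDegreeLT π n) :
    (imageMulX π n m : M) = (X : R[X]) • (m : M) := rfl

/-- The map `s ⊗ m ↦ s • m`. -/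
noncomputable def imageEval (n : ℕ) : R[X] ⊗[R] imageDegreeLT π n →ₗ[R[X]] M :=
  (imageDegreeLT π n).subtype.liftBaseChange R[X]

theorem imageEval_tmul (n : ℕ) (s : R[X]) (m : imageDegreeLT π n) :
    imageEval π n (s ⊗ₜ m) = s • (m : M) := by
  simp [imageEval]

theorem single_one_mem (n : ℕ) (j : Fin g) :
    π (Pi.single j 1) ∈ imageDegreeLT π (n + 1) :=
  ⟨_, by simpa using single_X_pow_mem_vectorsDegreeLT (R := R) n.succ_pos j, rfl⟩

theorem imageEval_surjective (hπ : Function.Surjective π) (n : ℕ) :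
    Function.Surjective (imageEval π (n + 1)) := by
  rw [← LinearMap.range_eq_top, eq_top_iff, ← LinearMap.range_eq_top.2 hπ]
  rintro _ ⟨v, rfl⟩
  have : v = ∑ j, v j • (Pi.single j 1 : Fin g → R[X]) := by
    conv_lhs => rw [← Finset.univ_sum_single v]
    refine Finset.sum_congr rfl fun j _ => ?_
    rw [← Pi.single_smul, smul_eq_mul, mul_one]
  rw [this, map_sum]
  refine sum_mem fun j _ => ?_
  rw [map_smul]
  exact ⟨v j ⊗ₜ ⟨_, single_one_mem π n j⟩, imageEval_tmul π _ _ _⟩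

/-- Modulo the image of `charMap`, a factor $X$ can be moved across the tensor sign. Hence the map
`θ` from the free module to the cokernel `Q`, with $e_j\mapsto 1\otimes\pi(e_j)$, sends every $v$ of
degree $\le n$ to $1\otimes\pi(v)$. The relations are generated in those degrees, so `θ` kills them
all, and the cokernel injects into $M$. -/
theorem exact_charMap_imageEval (n : ℕ) {s : Set (Fin g → R[X])}
    (hs : Submodule.span R[X] s = LinearMap.ker π)
    (hsn : ∀ v ∈ s, v ∈ vectorsDegreeLT R g (n + 1)) :
    Function.Exact (charMap (Submodule.inclusion (imageDegreeLT_le π n)) (imageMulX π n))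
      (imageEval π (n + 1)) := by
  set δ := charMap (Submodule.inclusion (imageDegreeLT_le π n)) (imageMulX π n) with hδ
  have hεδ : ∀ t, imageEval π (n + 1) (δ t) = 0 := by
    intro t
    induction t using TensorProduct.induction_on with
    | zero => simp
    | tmul s m =>
      rw [hδ, charMap_tmul, map_sub, imageEval_tmul, imageEval_tmul, coe_imageMulX,
        Submodule.coe_inclusion, mul_comm, mul_smul, sub_self]
    | add x y hx hy => rw [map_add, map_add, hx, hy, add_zero]
  intro t
  refine ⟨fun ht => ?_, ?_⟩
  swap
  · rintro ⟨t, rfl⟩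
    exact hεδ t
  let Q := (R[X] ⊗[R] imageDegreeLT π (n + 1)) ⧸ LinearMap.range δ
  let q : R[X] ⊗[R] imageDegreeLT π (n + 1) →ₗ[R[X]] Q := (LinearMap.range δ).mkQ
  let ι (v : vectorsDegreeLT R g (n + 1)) : imageDegreeLT π (n + 1) := ⟨π v.1, v.1, v.2, rfl⟩
  let θ : (Fin g → R[X]) →ₗ[R[X]] Q :=
    Fintype.linearCombination R[X] fun j => q (1 ⊗ₜ ⟨_, single_one_mem π n j⟩)
  have hX : ∀ (i : ℕ) (hi : i < n + 1) (j : Fin g), θ (Pi.single j (X ^ i)) =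
      q (1 ⊗ₜ ι ⟨_, single_X_pow_mem_vectorsDegreeLT hi j⟩) := by
    intro i
    induction i with
    | zero =>
      intro hi j
      simp only [pow_zero]
      rw [show θ (Pi.single j 1) = _ from Fintype.linearCombination_apply_single _ _ _ _, one_smul]
    | succ i ih =>
      intro hi j
      have h1 : (Pi.single j (X ^ (i + 1)) : Fin g → R[X]) =
          (X : R[X]) • Pi.single j (X ^ i) := by
        rw [← Pi.single_smul, smul_eq_mul, pow_succ']
      refine (congrArg θ h1).trans ?_
      rw [map_smul, ih (by omega), ← map_smul, ← sub_eq_zero, ← map_sub]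
      have hmem := single_X_pow_mem_vectorsDegreeLT (R := R) (n := n) (i := i) (by omega) j
      refine (Submodule.Quotient.mk_eq_zero _).2 ⟨1 ⊗ₜ ⟨π (Pi.single j (X ^ i)), _, hmem, rfl⟩, ?_⟩
      rw [hδ, charMap_tmul, TensorProduct.smul_tmul', smul_eq_mul]
      congr 2
      exact Subtype.ext (by
        rw [coe_imageMulX]
        exact ((congrArg π h1).trans (map_smul π _ _)).symm)
  have hθ : ∀ v : vectorsDegreeLT R g (n + 1), θ v.1 = q (1 ⊗ₜ ι v) := by
    rintro ⟨v, hv⟩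
    induction hv using Submodule.span_induction with
    | mem x hx =>
      obtain ⟨p, -, rfl⟩ := hx
      exact hX _ p.1.2 _
    | zero =>
      have : ι ⟨0, zero_mem _⟩ = 0 := Subtype.ext (map_zero π)
      simp [this]
    | add x y hx hy hx' hy' =>
      have : ι ⟨x + y, add_mem hx hy⟩ = ι ⟨x, hx⟩ + ι ⟨y, hy⟩ := Subtype.ext (map_add π x y)
      simp only at hx' hy' ⊢
      rw [map_add, hx', hy', this, TensorProduct.tmul_add, map_add]
    | smul r x hx hx' =>
      have : ι ⟨r • x, Submodule.smul_mem _ r hx⟩ = r • ι ⟨x, hx⟩ :=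
        Subtype.ext ((π.restrictScalars R).map_smul r x)
      simp only at hx' ⊢
      rw [this, TensorProduct.tmul_smul, algebra_compatible_smul R[X] r x,
        algebra_compatible_smul R[X] r ((1 : R[X]) ⊗ₜ[R] ι ⟨x, hx⟩), map_smul, map_smul, hx']
  have hθK : LinearMap.ker π ≤ LinearMap.ker θ := by
    rw [← hs, Submodule.span_le]
    intro v hv
    have h1 : ι ⟨v, hsn v hv⟩ = 0 :=
      Subtype.ext (LinearMap.mem_ker.1 (hs ▸ Submodule.subset_span hv : v ∈ LinearMap.ker π))
    exact LinearMap.mem_ker.2 (by rw [hθ ⟨v, hsn v hv⟩, h1, TensorProduct.tmul_zero, map_zero])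
  -- Evaluation and the quotient map are both controlled by one lift to the free module; if `t`
  -- evaluates to zero, this lift is a relation.
  have hlift : ∀ t : R[X] ⊗[R] imageDegreeLT π (n + 1),
      ∃ v, imageEval π (n + 1) t = π v ∧ q t = θ v := by
    intro t
    induction t using TensorProduct.induction_on with
    | zero => exact ⟨0, by simp⟩
    | tmul s m =>
      obtain ⟨_, v, hv, rfl⟩ := m
      refine ⟨s • v, by rw [imageEval_tmul, map_smul]; rfl, ?_⟩
      rw [map_smul, hθ ⟨v, hv⟩, ← map_smul, TensorProduct.smul_tmul', smul_eq_mul, mul_one]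
      rfl
    | add x y hx hy =>
      obtain ⟨v, hv, hv'⟩ := hx
      obtain ⟨w, hw, hw'⟩ := hy
      exact ⟨v + w, by simp [hv, hw], by simp [hv', hw']⟩
  obtain ⟨v, hv, hv'⟩ := hlift t
  rw [ht] at hv
  rw [LinearMap.mem_ker.1 (hθK (LinearMap.mem_ker.2 hv.symm))] at hv'
  exact (Submodule.Quotient.mk_eq_zero _).1 hv'

end Polynomial

open Polynomial in
/-- **Hilbert's syzygy theorem**, inductive step. -/
theorem FiniteModulesHaveFreeResolutions.polynomial {R : Type u} [CommRing R] [IsNoetherianRing R]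
    (h : FiniteModulesHaveFreeResolutions R) : FiniteModulesHaveFreeResolutions R[X] := by
  intro M _ _ _
  obtain ⟨g, f, hf⟩ := Module.Finite.exists_fin' R[X] M
  -- Unlike `M`, this quotient carries a compatible `R`-module structure.
  suffices H : ∃ n, HasFreeResolution R[X] n ((Fin g → R[X]) ⧸ LinearMap.ker f) by
    obtain ⟨n, hn⟩ := H
    exact ⟨n, hn.of_linearEquiv (f.quotKerEquivOfSurjective hf)⟩
  let π := (LinearMap.ker f).mkQ
  obtain ⟨s, hs⟩ : (LinearMap.ker f).FG := IsNoetherian.noetherian _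
  obtain ⟨n, hn⟩ := exists_generators_mem_vectorsDegreeLT (R := R) s
  have hfin : ∀ k, Module.Finite R (imageDegreeLT π k) := fun k =>
    Module.Finite.of_fg ((vectorsDegreeLT_fg g k).map _)
  obtain ⟨a, ha⟩ := h (imageDegreeLT π n)
  obtain ⟨b, hb⟩ := h (imageDegreeLT π (n + 1))
  exact ⟨_, HasFreeResolution.of_quotient _ _
    (charMap_injective _ (imageMulX π n) (Submodule.inclusion_injective (imageDegreeLT_le π n)))
    (exact_charMap_imageEval π n (s := s) (by rw [hs, Submodule.ker_mkQ])
      fun v hv => vectorsDegreeLT_mono g n.le_succ (hn v hv))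
    (imageEval_surjective π (Submodule.mkQ_surjective _) n)
    ((ha.mono (le_max_left a b)).baseChange R[X])
    ((hb.mono ((le_max_right a b).trans (Nat.le_succ _))).baseChange R[X])⟩

/-- **Hilbert's syzygy theorem**. -/
theorem FiniteModulesHaveFreeResolutions.mvPolynomial (k : Type u) [Field k] (d : ℕ) :
    FiniteModulesHaveFreeResolutions (MvPolynomial (Fin d) k) := by
  induction d with
  | zero =>
    exact (FiniteModulesHaveFreeResolutions.of_field k).of_ringEquiv
      (MvPolynomial.isEmptyRingEquiv k (Fin 0)).symm
  | succ d ih => exact ih.polynomial.of_ringEquiv (MvPolynomial.finSuccEquiv k d).symm.toRingEquiv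

/-- `HasFreeResolution` keeps ring and module in one universe; replacing `M` by a quotient of a free
module removes that restriction. -/
theorem Arveson.FiniteFreeResolution.nonempty_of_finite (k : Type u) [Field k] (d : ℕ)
    (M : Type v) [AddCommGroup M] [Module (MvPolynomial (Fin d) k) M]
    [Module.Finite (MvPolynomial (Fin d) k) M] :
    Nonempty (FiniteFreeResolution (MvPolynomial (Fin d) k) M) := by
  obtain ⟨g, f, hf⟩ := Module.Finite.exists_fin' (MvPolynomial (Fin d) k) M
  obtain ⟨n, hn⟩ := FiniteModulesHaveFreeResolutions.mvPolynomial k d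
    ((Fin g → MvPolynomial (Fin d) k) ⧸ LinearMap.ker f)
  exact hn.nonempty.map (ofLinearEquiv (f.quotKerEquivOfSurjective hf))

end

/-! ### Hilbert functions over polynomial rings -/

section

open scoped Nat

namespace MvPolynomial

theorem sum_range_multichoose (d n : ℕ) :
    ∑ j ∈ Finset.range (n + 1), d.multichoose j = (n + d).choose d := by
  have h : ∑ j ∈ Finset.range (n + 1), d.multichoose j = (d + 1).multichoose n := by
    induction n with
    | zero => simp
    | succ n ih => rw [Finset.sum_range_succ, ih, Nat.multichoose_succ_succ, add_comm]
  rw [h, Nat.multichoose_eq, show d + 1 + n - 1 = n + d by omega, Nat.choose_symm_add]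

theorem finrank_restrictTotalDegree (k : Type*) [Field k] (d n : ℕ) :
    Module.finrank k (restrictTotalDegree (Fin d) k n) = (n + d).choose d := by
  classical
  have hS : {s : Fin d →₀ ℕ | (s.sum fun _ e => e) ≤ n} =
      ((Finset.range (n + 1)).biUnion fun j => Finset.finsuppAntidiag Finset.univ j :
        Finset (Fin d →₀ ℕ)) := by
    ext s
    have : (s.sum fun _ e => e) = ∑ i, s i := Finsupp.sum_fintype _ _ fun _ => rfl
    simp [this, Finset.mem_finsuppAntidiag]
  rw [restrictTotalDegree, Module.finrank_eq_nat_card_basis (basisRestrictSupport k _), hS,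
    Nat.card_coe_set_eq, Set.ncard_coe_finset, Finset.card_biUnion, ← sum_range_multichoose]
  · simp [Finset.card_finsuppAntidiag_nat_eq_multichoose]
  · intro i _ j _ hij
    change Disjoint (Finset.finsuppAntidiag _ i) (Finset.finsuppAntidiag _ j)
    rw [Finset.disjoint_left]
    intro s hs hs'
    rw [Finset.mem_finsuppAntidiag] at hs hs'
    exact hij (hs.1.symm.trans hs'.1)

section HilbertFunction

variable {k : Type*} [Field k] {d : ℕ}

/-- Linear independence makes $(p_i)\mapsto\sum p_ix_i$ injective on tuples of polynomials of degree
$\le m$. This is applied both to a module and to its module of relations. -/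
theorem mul_choose_le_finrank {N : Type*} [AddCommGroup N] [Module (MvPolynomial (Fin d) k) N]
    [Module k N] [IsScalarTower k (MvPolynomial (Fin d) k) N] {ρ m : ℕ} {x : Fin ρ → N}
    (hx : LinearIndependent (MvPolynomial (Fin d) k) x) (W : Submodule k N) [FiniteDimensional k W]
    (hW : ∀ (p : MvPolynomial (Fin d) k) (i : Fin ρ), p.totalDegree ≤ m → p • x i ∈ W) :
    ρ * (m + d).choose d ≤ Module.finrank k W := by
  let f : (Fin ρ → restrictTotalDegree (Fin d) k m) →ₗ[k] W :=
    LinearMap.codRestrict W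
      (((Fintype.linearCombination (MvPolynomial (Fin d) k) x).restrictScalars k) ∘ₗ
        LinearMap.compLeft (restrictTotalDegree (Fin d) k m).subtype (Fin ρ))
      (fun p => by
        simp only [LinearMap.comp_apply, LinearMap.restrictScalars_apply,
          Fintype.linearCombination_apply]
        exact sum_mem fun i _ => hW _ _ ((mem_restrictTotalDegree _ _ _).1 (p i).2))
  have hf : Function.Injective f := by
    intro p q hpq
    have := (linearIndependent_iff_injective_fintypeLinearCombination.1 hx) (congrArg Subtype.val hpq)
    funext i
    exact Subtype.ext (congrFun this i)
  have h := LinearMap.finrank_le_finrank_of_injective hf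
  rwa [Module.finrank_pi_fintype, Finset.sum_const, Finset.card_univ, Fintype.card_fin,
    smul_eq_mul, finrank_restrictTotalDegree] at h

variable (k d) in
/-- Vectors of polynomials of total degree at most `n`. -/
noncomputable def vectorsTotalDegreeLE (g n : ℕ) :
    Submodule k (Fin g → MvPolynomial (Fin d) k) :=
  Submodule.pi Set.univ fun _ => restrictTotalDegree (Fin d) k n

theorem mem_vectorsTotalDegreeLE {g n : ℕ} {v : Fin g → MvPolynomial (Fin d) k} :
    v ∈ vectorsTotalDegreeLE k d g n ↔ ∀ i, (v i).totalDegree ≤ n := by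
  simp [vectorsTotalDegreeLE, Submodule.mem_pi, mem_restrictTotalDegree]

theorem exists_mem_vectorsTotalDegreeLE {g ρ : ℕ} (v : Fin ρ → Fin g → MvPolynomial (Fin d) k) :
    ∃ c, ∀ i, v i ∈ vectorsTotalDegreeLE k d g c := by
  refine ⟨Finset.univ.sup fun i => Finset.univ.sup fun j => (v i j).totalDegree, fun i => ?_⟩
  rw [mem_vectorsTotalDegreeLE]
  intro j
  exact (Finset.le_sup (f := fun j => (v i j).totalDegree) (Finset.mem_univ j)).trans
    (Finset.le_sup (f := fun i => Finset.univ.sup fun j => (v i j).totalDegree)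
      (Finset.mem_univ i))

theorem smul_mem_vectorsTotalDegreeLE {g m c n : ℕ} {p : MvPolynomial (Fin d) k}
    {v : Fin g → MvPolynomial (Fin d) k} (hp : p.totalDegree ≤ m)
    (hv : v ∈ vectorsTotalDegreeLE k d g c) (h : m + c ≤ n) :
    p • v ∈ vectorsTotalDegreeLE k d g n := by
  rw [mem_vectorsTotalDegreeLE] at hv ⊢
  intro i
  have h1 := totalDegree_mul p (v i)
  have h2 := hv i
  rw [Pi.smul_apply, smul_eq_mul]
  omega

/-- `vectorsTotalDegreeLE` as a power of the space of polynomials of bounded degree. -/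
noncomputable def vectorsTotalDegreeLEEquiv (g n : ℕ) :
    vectorsTotalDegreeLE k d g n ≃ₗ[k] (Fin g → restrictTotalDegree (Fin d) k n) where
  toFun v i := ⟨v.1 i, v.2 i trivial⟩
  invFun v := ⟨fun i => v i, fun i _ => (v i).2⟩
  map_add' _ _ := rfl
  map_smul' _ _ := rfl

instance (g n : ℕ) : FiniteDimensional k (vectorsTotalDegreeLE k d g n) :=
  Module.Finite.equiv (vectorsTotalDegreeLEEquiv g n).symm

theorem finrank_vectorsTotalDegreeLE (g n : ℕ) :
    Module.finrank k (vectorsTotalDegreeLE k d g n) = g * (n + d).choose d := by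
  rw [(vectorsTotalDegreeLEEquiv g n).finrank_eq, Module.finrank_pi_fintype, Finset.sum_const,
    Finset.card_univ, Fintype.card_fin, smul_eq_mul, finrank_restrictTotalDegree]

/-- A bounded shift does not affect the leading term of $\binom{N}{d}\sim N^d/d!$; truncation of `n
- c` matters only for finitely many `n`. -/
theorem tendsto_factorial_mul_choose_div_pow (d c : ℕ) :
    Tendsto (fun n : ℕ => (d ! : ℝ) * (((n - c + d).choose d : ℕ) : ℝ) / (n : ℝ) ^ d)
      atTop (𝓝 1) := by
  have h1 : Tendsto (fun n : ℕ => n - c + d) atTop atTop :=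
    tendsto_atTop_mono (fun _ => Nat.le_add_right _ _) (tendsto_sub_atTop_nat c)
  have h2 := (isEquivalent_choose d).comp_tendsto h1
  have h3 : Tendsto (fun n : ℕ => (((n - c + d : ℕ) : ℝ) / n)) atTop (𝓝 1) := by
    have h4 : Tendsto (fun n : ℕ => 1 + ((d : ℝ) - c) / n) atTop (𝓝 (1 + 0)) :=
      tendsto_const_nhds.add (tendsto_const_div_atTop_nhds_zero_nat _)
    rw [add_zero] at h4
    refine h4.congr' ?_
    filter_upwards [eventually_ge_atTop (c + 1)] with n hn
    have hn0 : (n : ℝ) ≠ 0 := by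
      have : n ≠ 0 := by omega
      exact_mod_cast this
    rw [Nat.cast_add, Nat.cast_sub (by omega)]
    field_simp
    ring
  have h5 := h3.pow d
  rw [one_pow] at h5
  have h6 : Asymptotics.IsEquivalent atTop
      (fun n : ℕ => (d ! : ℝ) * (((n - c + d).choose d : ℕ) : ℝ) / (n : ℝ) ^ d)
      (fun n : ℕ => (((n - c + d : ℕ) : ℝ) / n) ^ d) := by
    have h7 := ((Asymptotics.IsEquivalent.refl (u := fun n : ℕ => (d ! : ℝ)) (l := atTop)).mul
      h2).div (Asymptotics.IsEquivalent.refl (u := fun n : ℕ => (n : ℝ) ^ d) (l := atTop))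
    refine h7.congr_right (Eventually.of_forall fun n => ?_)
    have : (d ! : ℝ) ≠ 0 := by positivity
    rw [Pi.div_apply, Pi.mul_apply, Function.comp_apply]
    beta_reduce
    rw [div_pow]
    field_simp
  exact h6.symm.tendsto_nhds h5

/-- The leading coefficient of the Hilbert function of a finitely generated module is its rank. -/
theorem tendsto_factorial_mul_finrank_map_div_pow {M : Type*} [AddCommGroup M]
    [Module (MvPolynomial (Fin d) k) M] [Module k M] [IsScalarTower k (MvPolynomial (Fin d) k) M]
    {g : ℕ} (π : (Fin g → MvPolynomial (Fin d) k) →ₗ[MvPolynomial (Fin d) k] M)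
    (hπ : Function.Surjective π) :
    Tendsto (fun n : ℕ => (d ! : ℝ) *
      ((Module.finrank k ((vectorsTotalDegreeLE k d g n).map (π.restrictScalars k)) : ℝ) /
        (n : ℝ) ^ d)) atTop (𝓝 (Module.finrank (MvPolynomial (Fin d) k) M : ℝ)) := by
  set A := MvPolynomial (Fin d) k
  set V := fun n => vectorsTotalDegreeLE k d g n
  set W := fun n => (V n).map (π.restrictScalars k)
  set K := fun n => LinearMap.ker (π.restrictScalars k) ⊓ V n
  set ρ := Module.finrank A M
  set κ := Module.finrank A (LinearMap.ker π)
  have hfin : Module.Finite A M := Module.Finite.of_surjective π hπ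
  have hρκ : ρ + κ = g := by
    have h := Submodule.finrank_quotient_add_finrank (LinearMap.ker π)
    rwa [(π.quotKerEquivOfSurjective hπ).finrank_eq, Module.finrank_fin_fun] at h
  -- Rank-nullity for `π` restricted to `V n`: a lower bound for the relations becomes an upper
  -- bound for `W n`.
  have hWK : ∀ n, Module.finrank k (W n) + Module.finrank k (K n) = g * (n + d).choose d := by
    intro n
    rw [← finrank_vectorsTotalDegreeLE (k := k) (d := d) g n,
      ← LinearMap.finrank_range_add_finrank_ker ((π.restrictScalars k).domRestrict (V n)),
      LinearMap.range_domRestrict]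
    congr 1
    rw [LinearMap.ker_domRestrict, ← Submodule.finrank_map_subtype_eq,
      Submodule.map_comap_subtype, inf_comm]
  obtain ⟨x, hx⟩ := exists_linearIndependent_of_le_finrank (R := A) (M := M) le_rfl
  obtain ⟨y, hy⟩ := exists_linearIndependent_of_le_finrank (R := A) (M := LinearMap.ker π) le_rfl
  choose x' hx' using fun i => hπ (x i)
  -- `c` and `c'` bound the degrees of the chosen independent elements, so multipliers of degree `n
  -- - c` or `n - c'` stay within degree `n`.
  obtain ⟨c, hc⟩ := exists_mem_vectorsTotalDegreeLE x'
  obtain ⟨c', hc'⟩ := exists_mem_vectorsTotalDegreeLE fun i => (y i).1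
  have hW : ∀ n, c ≤ n → ρ * (n - c + d).choose d ≤ Module.finrank k (W n) := fun n hn =>
    mul_choose_le_finrank hx (W n) fun p i hp =>
      ⟨p • x' i, smul_mem_vectorsTotalDegreeLE hp (hc i) (by omega), by
        rw [LinearMap.restrictScalars_apply, map_smul, hx']⟩
  have hy' : LinearIndependent A fun i => (y i).1 :=
    hy.map' (LinearMap.ker π).subtype (Submodule.ker_subtype _)
  have hK : ∀ n, c' ≤ n → κ * (n - c' + d).choose d ≤ Module.finrank k (K n) := fun n hn =>
    mul_choose_le_finrank hy' (K n) fun p i hp =>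
      ⟨((LinearMap.ker π).smul_mem p (y i).2 :),
        smul_mem_vectorsTotalDegreeLE hp (hc' i) (by omega)⟩
  have hl := (tendsto_factorial_mul_choose_div_pow d c).const_mul (ρ : ℝ)
  have hu := ((tendsto_factorial_mul_choose_div_pow d 0).const_mul (g : ℝ)).sub
    ((tendsto_factorial_mul_choose_div_pow d c').const_mul (κ : ℝ))
  have hgκ : (g : ℝ) * 1 - κ * 1 = ρ := by rw [← hρκ]; push_cast; ring
  rw [hgκ] at hu
  rw [mul_one] at hl
  refine tendsto_of_tendsto_of_tendsto_of_le_of_le' hl hu ?_ ?_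
  · filter_upwards [eventually_ge_atTop c] with n hn
    have h : (ρ : ℝ) * ((n - c + d).choose d : ℕ) ≤ Module.finrank k (W n) := by
      exact_mod_cast hW n hn
    calc (ρ : ℝ) * (d ! * ((n - c + d).choose d : ℕ) / (n : ℝ) ^ d)
        = d ! * ((ρ * ((n - c + d).choose d : ℕ)) / (n : ℝ) ^ d) := by ring
      _ ≤ _ := by gcongr
  · filter_upwards [eventually_ge_atTop c'] with n hn
    have h1 : (κ : ℝ) * ((n - c' + d).choose d : ℕ) ≤ Module.finrank k (K n) := by
      exact_mod_cast hK n hn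
    have h2 : (Module.finrank k (W n) : ℝ) + Module.finrank k (K n) =
        g * ((n + d).choose d : ℕ) := by
      exact_mod_cast hWK n
    have h3 : (Module.finrank k (W n) : ℝ) ≤
        g * ((n + d).choose d : ℕ) - κ * ((n - c' + d).choose d : ℕ) := by linarith
    calc (d ! : ℝ) * ((Module.finrank k (W n) : ℝ) / (n : ℝ) ^ d)
        ≤ d ! * ((g * ((n + d).choose d : ℕ) - κ * ((n - c' + d).choose d : ℕ)) / (n : ℝ) ^ d) := by
          gcongr
      _ = _ := by rw [Nat.sub_zero]; ring

end HilbertFunction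

end MvPolynomial

end

/-! ### Ranges of the operators $1-\phi^{n+1}(1)$ -/

section

open scoped InnerProductSpace ComplexOrder

namespace Arveson

variable {d : ℕ} {H : Type*} [NormedAddCommGroup H] [InnerProductSpace ℂ H] [CompleteSpace H]
  [Module (PolyAlg d) H] [IsScalarTower ℂ (PolyAlg d) H] (hH : IsContractive d H)

theorem phi_apply (X : H →L[ℂ] H) (ξ : H) :
    phi hH X ξ = ∑ k, coordOp hH k (X (ContinuousLinearMap.adjoint (coordOp hH k) ξ)) := by
  simp [phi]

theorem inner_phi_apply (X : H →L[ℂ] H) (ξ : H) :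
    ⟪phi hH X ξ, ξ⟫_ℂ = ∑ k, ⟪X (ContinuousLinearMap.adjoint (coordOp hH k) ξ),
      ContinuousLinearMap.adjoint (coordOp hH k) ξ⟫_ℂ := by
  simp only [phi_apply, sum_inner, ContinuousLinearMap.adjoint_inner_right]

theorem phi_isPositive {X : H →L[ℂ] H} (hX : X.IsPositive) : (phi hH X).IsPositive := by
  refine ContinuousLinearMap.isPositive_sum _ fun k _ => ?_
  exact hX.conj_adjoint (coordOp hH k)

theorem phi_sub (X Y : H →L[ℂ] H) : phi hH (X - Y) = phi hH X - phi hH Y := by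
  simp [phi, mul_sub, sub_mul, Finset.sum_sub_distrib]

theorem phi_one : phi hH 1 =
    ∑ k, coordOp hH k * ContinuousLinearMap.adjoint (coordOp hH k) := by
  simp [phi]

/-- Contractivity at $\xi_k=T_k^*\xi$ gives $\|\phi(1)\xi\|^2\le\langle\phi(1)\xi,\xi\rangle$; with
Cauchy–Schwarz this forces $\langle\phi(1)\xi,\xi\rangle\le\|\xi\|^2$. -/
theorem one_sub_phi_one_isPositive : (1 - phi hH 1).IsPositive := by
  have hP := phi_isPositive hH (ContinuousLinearMap.isPositive_one (𝕜 := ℂ) (E := H))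
  have hre : ∀ ξ, (⟪phi hH 1 ξ, ξ⟫_ℂ).re =
      ∑ k, ‖ContinuousLinearMap.adjoint (coordOp hH k) ξ‖ ^ 2 := fun ξ => by
    rw [inner_phi_apply, Complex.re_sum]
    exact Finset.sum_congr rfl fun k _ => inner_self_eq_norm_sq (𝕜 := ℂ) _
  have hle : ∀ ξ, ‖phi hH 1 ξ‖ ^ 2 ≤ (⟪phi hH 1 ξ, ξ⟫_ℂ).re := fun ξ => by
    rw [hre, phi_apply]
    exact hH fun k => ContinuousLinearMap.adjoint (coordOp hH k) ξ
  have hcs : ∀ ξ, (⟪phi hH 1 ξ, ξ⟫_ℂ).re ≤ ‖phi hH 1 ξ‖ * ‖ξ‖ := fun ξ =>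
    (Complex.re_le_norm _).trans (norm_inner_le_norm _ _)
  refine (ContinuousLinearMap.isPositive_def').2 ⟨(IsSelfAdjoint.one _).sub hP.isSelfAdjoint,
    fun ξ => ?_⟩
  rw [ContinuousLinearMap.reApplyInnerSelf_apply, sub_apply, inner_sub_left,
    map_sub, one_apply_eq_self, inner_self_eq_norm_sq]
  have h1 := hle ξ
  have h2 := hcs ξ
  change 0 ≤ ‖ξ‖ ^ 2 - (⟪phi hH 1 ξ, ξ⟫_ℂ).re
  nlinarith [norm_nonneg ξ, norm_nonneg (phi hH 1 ξ), sq_nonneg (‖ξ‖ - ‖phi hH 1 ξ‖)]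

theorem defect_isPositive : (defect hH).IsPositive :=
  (ContinuousLinearMap.nonneg_iff_isPositive _).1 (CFC.sqrt_nonneg _)

theorem defect_mul_self : defect hH * defect hH = 1 - phi hH 1 := by
  have h : (0 : H →L[ℂ] H) ≤ 1 - phi hH 1 :=
    (ContinuousLinearMap.nonneg_iff_isPositive _).2 (one_sub_phi_one_isPositive hH)
  rw [defect, ← phi_one, CFC.sqrt_mul_sqrt_self _ h]

/-- The spaces `span {f • Δ ξ : deg f ≤ n}`, defined recursively. -/
noncomputable def degreeSpace : ℕ → Submodule ℂ H
  | 0 => LinearMap.range (defect hH : H →ₗ[ℂ] H)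
  | n + 1 => LinearMap.range (defect hH : H →ₗ[ℂ] H) ⊔
      ⨆ k, (degreeSpace n).map (coordOp hH k : H →ₗ[ℂ] H)

theorem finiteDimensional_degreeSpace (hfin : HasFiniteRank hH) (n : ℕ) :
    FiniteDimensional ℂ (degreeSpace hH n) := by
  have h0 : FiniteDimensional ℂ (LinearMap.range (defect hH : H →ₗ[ℂ] H)) := hfin
  induction n with
  | zero => exact h0
  | succ n ih => rw [degreeSpace]; infer_instance

theorem inner_defect_mul_self (ξ : H) : ⟪(1 - phi hH 1) ξ, ξ⟫_ℂ = (‖defect hH ξ‖ ^ 2 : ℝ) := by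
  rw [← defect_mul_self, mul_apply_eq_comp,
    (defect_isPositive hH).inner_left_eq_inner_right, inner_self_eq_norm_sq_to_K]
  norm_cast

/-- This recursion mirrors the one defining `degreeSpace`, which lets the two be compared by
induction. -/
theorem one_sub_iterate_phi_succ (n : ℕ) : 1 - (phi hH)^[n + 1 + 1] 1 =
    (1 - phi hH 1) + phi hH (1 - (phi hH)^[n + 1] 1) := by
  rw [Function.iterate_succ_apply', phi_sub]
  abel

theorem one_sub_iterate_phi_isPositive (n : ℕ) : (1 - (phi hH)^[n + 1] 1).IsPositive := by
  induction n with
  | zero => exact one_sub_phi_one_isPositive hH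
  | succ n ih =>
    rw [one_sub_iterate_phi_succ]
    exact (one_sub_phi_one_isPositive hH).add (phi_isPositive hH ih)

/-- With $S=T^{1/2}$, the inner product is $\|S\xi\|^2$. -/
theorem _root_.ContinuousLinearMap.IsPositive.inner_eq_zero_iff {T : H →L[ℂ] H}
    (hT : T.IsPositive) (ξ : H) : ⟪T ξ, ξ⟫_ℂ = 0 ↔ T ξ = 0 := by
  refine ⟨fun h => ?_, fun h => by rw [h, inner_zero_left]⟩
  have hT' : 0 ≤ T := (ContinuousLinearMap.nonneg_iff_isPositive _).2 hT
  have hS : (CFC.sqrt T).IsPositive :=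
    (ContinuousLinearMap.nonneg_iff_isPositive _).1 (CFC.sqrt_nonneg _)
  rw [← CFC.sqrt_mul_sqrt_self T hT', mul_apply_eq_comp] at h ⊢
  rw [hS.inner_left_eq_inner_right, inner_self_eq_zero] at h
  rw [h, map_zero]

/-- The quadratic form of the operator is a sum of nonnegative terms, so it vanishes exactly when
each term does; orthogonality to a sum of subspaces splits in the same way, with $T_k$ moved to
$T_k^*$. -/
theorem mem_degreeSpace_orthogonal_iff (n : ℕ) (ξ : H) :
    ξ ∈ (degreeSpace hH n)ᗮ ↔ (1 - (phi hH)^[n + 1] 1) ξ = 0 := by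
  have h0 : ∀ ξ, ξ ∈ (LinearMap.range (defect hH : H →ₗ[ℂ] H))ᗮ ↔ defect hH ξ = 0 := fun ξ => by
    rw [Submodule.mem_orthogonal]
    constructor
    · intro h
      have := h _ ⟨defect hH ξ, rfl⟩
      rwa [ContinuousLinearMap.coe_coe, (defect_isPositive hH).inner_left_eq_inner_right,
        inner_self_eq_zero] at this
    · rintro h _ ⟨η, rfl⟩
      rw [ContinuousLinearMap.coe_coe, (defect_isPositive hH).inner_left_eq_inner_right, h,
        inner_zero_right]
  have h1 : ∀ ξ, ⟪(1 - phi hH 1) ξ, ξ⟫_ℂ = 0 ↔ defect hH ξ = 0 := fun ξ => by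
    rw [inner_defect_mul_self]; simp
  induction n generalizing ξ with
  | zero =>
    rw [degreeSpace, h0, ← h1, (one_sub_phi_one_isPositive hH).inner_eq_zero_iff]
    rfl
  | succ n ih =>
    have hpos := one_sub_iterate_phi_isPositive hH n
    rw [← (one_sub_iterate_phi_isPositive hH (n + 1)).inner_eq_zero_iff,
      one_sub_iterate_phi_succ, add_apply, inner_add_left,
      add_eq_zero_iff_of_nonneg ((one_sub_phi_one_isPositive hH).inner_nonneg_left ξ)
        ((phi_isPositive hH hpos).inner_nonneg_left ξ), h1, inner_phi_apply,
      Finset.sum_eq_zero_iff_of_nonneg fun k _ => hpos.inner_nonneg_left _, degreeSpace,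
      ← Submodule.inf_orthogonal, Submodule.mem_inf, h0, ← Submodule.iInf_orthogonal,
      Submodule.mem_iInf]
    refine and_congr_right fun _ => forall_congr' fun k => ?_
    rw [hpos.inner_eq_zero_iff]
    simp only [← ih (ContinuousLinearMap.adjoint (coordOp hH k) ξ), Finset.mem_univ, true_imp_iff, Submodule.mem_orthogonal, Submodule.mem_map,
      forall_exists_index, and_imp, forall_apply_eq_imp_iff₂, ContinuousLinearMap.coe_coe,
      ContinuousLinearMap.adjoint_inner_right]

/-- The kernel of a self-adjoint operator is the orthogonal complement of its range. Finite
dimension makes both spaces equal to their double complements, so equal complements suffice. -/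
theorem range_one_sub_iterate_phi (hfin : HasFiniteRank hH) (n : ℕ) :
    LinearMap.range ((1 - (phi hH)^[n + 1] 1 : H →L[ℂ] H) : H →ₗ[ℂ] H) = degreeSpace hH n := by
  have hM := finiteDimensional_degreeSpace hH hfin n
  have hpos := one_sub_iterate_phi_isPositive hH n
  set S := 1 - (phi hH)^[n + 1] 1 with hS
  have hle : LinearMap.range (S : H →ₗ[ℂ] H) ≤ degreeSpace hH n := by
    rw [← Submodule.orthogonal_orthogonal (degreeSpace hH n)]
    rintro _ ⟨η, rfl⟩
    rw [Submodule.mem_orthogonal]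
    intro ξ hξ
    rw [mem_degreeSpace_orthogonal_iff, ← hS] at hξ
    rw [ContinuousLinearMap.coe_coe, ← hpos.inner_left_eq_inner_right, hξ, inner_zero_left]
  have hR : FiniteDimensional ℂ (LinearMap.range (S : H →ₗ[ℂ] H)) :=
    Submodule.finiteDimensional_of_le hle
  refine le_antisymm hle ?_
  rw [← Submodule.orthogonal_orthogonal (LinearMap.range (S : H →ₗ[ℂ] H))]
  refine (Submodule.le_orthogonal_orthogonal _).trans (Submodule.orthogonal_le ?_)
  intro ξ hξ
  rw [mem_degreeSpace_orthogonal_iff, ← hS]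
  have := (Submodule.mem_orthogonal _ _).1 hξ _ ⟨S ξ, rfl⟩
  rwa [ContinuousLinearMap.coe_coe, hpos.inner_left_eq_inner_right, inner_self_eq_zero] at this

end Arveson

end

/-! ### The degree filtration of $M_H$ -/

namespace Arveson

section Generators

variable {d : ℕ} {H : Type*} [NormedAddCommGroup H] [InnerProductSpace ℂ H] [CompleteSpace H]
  [Module (PolyAlg d) H] [IsScalarTower ℂ (PolyAlg d) H] (hH : IsContractive d H)

theorem range_defect_le_degreeSpace (n : ℕ) :
    LinearMap.range (defect hH : H →ₗ[ℂ] H) ≤ degreeSpace hH n := by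
  cases n with
  | zero => exact le_rfl
  | succ n => exact le_sup_left

theorem X_smul_mem_degreeSpace {n : ℕ} {ξ : H} (hξ : ξ ∈ degreeSpace hH n) (k : Fin d) :
    (MvPolynomial.X k : PolyAlg d) • ξ ∈ degreeSpace hH (n + 1) :=
  (le_sup_right : _ ≤ degreeSpace hH (n + 1))
    (Submodule.mem_iSup_of_mem k ⟨ξ, hξ, rfl⟩)

theorem smul_mem_degreeSpace {n : ℕ} {p : PolyAlg d} (hp : p.totalDegree ≤ n) {ξ : H}
    (hξ : ξ ∈ LinearMap.range (defect hH : H →ₗ[ℂ] H)) : p • ξ ∈ degreeSpace hH n := by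
  have key : ∀ (n : ℕ) (m : Fin d →₀ ℕ) (c : ℂ), m.degree ≤ n →
      (MvPolynomial.monomial m c : PolyAlg d) • ξ ∈ degreeSpace hH n := by
    have hC : ∀ n (c : ℂ), (MvPolynomial.monomial 0 c : PolyAlg d) • ξ ∈ degreeSpace hH n :=
      fun n c => by
        have : (MvPolynomial.monomial 0 c : PolyAlg d) = algebraMap ℂ (PolyAlg d) c := rfl
        rw [this, algebraMap_smul]
        exact Submodule.smul_mem _ c (range_defect_le_degreeSpace hH n hξ)
    intro n
    induction n with
    | zero =>
      intro m c hm
      rw [(Finsupp.degree_eq_zero_iff m).1 (Nat.le_zero.1 hm)]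
      exact hC 0 c
    | succ n ih =>
      intro m c hm
      by_cases h0 : m = 0
      · rw [h0]
        exact hC _ c
      -- A nonconstant monomial has a variable to peel off, which costs one step of the filtration.
      · obtain ⟨k, hk⟩ := Finsupp.ne_iff.1 h0
        have hm' : m = Finsupp.single k 1 + (m - Finsupp.single k 1) := by
          rw [add_tsub_cancel_of_le]
          exact Finsupp.single_le_iff.2 (Nat.one_le_iff_ne_zero.2 hk)
        have hdeg := congrArg Finsupp.degree hm'
        rw [map_add, Finsupp.degree_single] at hdeg
        have hmul : (MvPolynomial.monomial m c : PolyAlg d) = MvPolynomial.X k *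
            MvPolynomial.monomial (m - Finsupp.single k 1) c := by
          rw [MvPolynomial.X, MvPolynomial.monomial_mul, one_mul, ← hm']
        rw [hmul, mul_smul]
        exact X_smul_mem_degreeSpace hH (ih _ c (by omega)) k
  rw [p.as_sum, Finset.sum_smul]
  exact sum_mem fun m hm => key n m _ ((MvPolynomial.le_totalDegree hm).trans hp)

variable {r : ℕ} {b : Fin r → H}

/-- Identifies the filtration coming from the operators with the one whose dimensions form a Hilbert
function. -/
theorem map_vectorsTotalDegreeLE_eq_degreeSpace
    (hb : Submodule.span ℂ (Set.range b) = LinearMap.range (defect hH : H →ₗ[ℂ] H)) (n : ℕ) :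
    (MvPolynomial.vectorsTotalDegreeLE ℂ d r n).map
      ((Fintype.linearCombination (PolyAlg d) b).restrictScalars ℂ) = degreeSpace hH n := by
  refine le_antisymm ?_ ?_
  · rintro _ ⟨v, hv, rfl⟩
    rw [LinearMap.restrictScalars_apply, Fintype.linearCombination_apply]
    exact sum_mem fun i _ => smul_mem_degreeSpace hH
      (MvPolynomial.mem_vectorsTotalDegreeLE.1 hv i) (hb ▸ Submodule.subset_span ⟨i, rfl⟩)
  · have h0 : ∀ n, LinearMap.range (defect hH : H →ₗ[ℂ] H) ≤
        (MvPolynomial.vectorsTotalDegreeLE ℂ d r n).map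
          ((Fintype.linearCombination (PolyAlg d) b).restrictScalars ℂ) := by
      intro n
      rw [← hb, Submodule.span_le]
      rintro _ ⟨i, rfl⟩
      refine ⟨Pi.single i 1, MvPolynomial.mem_vectorsTotalDegreeLE.2 fun j => ?_, ?_⟩
      · by_cases h : j = i
        · subst h; simp
        · simp [h]
      · rw [LinearMap.restrictScalars_apply, Fintype.linearCombination_apply_single, one_smul]
    induction n with
    | zero => exact h0 0
    | succ n ih =>
      refine sup_le (h0 _) (iSup_le fun k => ?_)
      rintro _ ⟨ξ, hξ, rfl⟩
      obtain ⟨v, hv, rfl⟩ := ih hξ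
      exact ⟨(MvPolynomial.X k : PolyAlg d) • v,
        MvPolynomial.smul_mem_vectorsTotalDegreeLE (MvPolynomial.totalDegree_X k).le hv
          (by omega), map_smul (Fintype.linearCombination (PolyAlg d) b) _ _⟩

theorem range_linearCombination_eq_algModule
    (hb : Submodule.span ℂ (Set.range b) = LinearMap.range (defect hH : H →ₗ[ℂ] H)) :
    LinearMap.range (Fintype.linearCombination (PolyAlg d) b) = algModule hH := by
  rw [Fintype.range_linearCombination]
  refine le_antisymm (Submodule.span_mono ?_) (Submodule.span_le.2 ?_)
  · rintro _ ⟨i, rfl⟩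
    exact (hb ▸ Submodule.subset_span ⟨i, rfl⟩ :
      b i ∈ LinearMap.range (defect hH : H →ₗ[ℂ] H))
  · intro ξ hξ
    exact Submodule.span_le_restrictScalars ℂ (PolyAlg d) _
      (hb ▸ hξ : ξ ∈ Submodule.span ℂ (Set.range b))

end Generators

theorem moduleEulerChar_eq_finrank {R : Type*} [CommRing R] [IsDomain R] {M : Type*}
    [AddCommGroup M] [Module R M] (h : Nonempty (FiniteFreeResolution R M)) :
    moduleEulerChar R M = Module.finrank R M := by
  rw [moduleEulerChar, dif_pos h, FiniteFreeResolution.alternatingSum_eq_finrank]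

end Arveson

/-! ### The main theorem -/

open Arveson in
theorem theoremC (d : ℕ) (H : Type*) [NormedAddCommGroup H] [InnerProductSpace ℂ H]
    [CompleteSpace H] [Module (Arveson.PolyAlg d) H] [IsScalarTower ℂ (Arveson.PolyAlg d) H]
    (hH : Arveson.IsContractive d H) (hfin : Arveson.HasFiniteRank hH) :
    Nonempty (Arveson.FiniteFreeResolution (Arveson.PolyAlg d) (Arveson.algModule hH)) ∧
    (∀ F : Arveson.FiniteFreeResolution (Arveson.PolyAlg d) (Arveson.algModule hH),
      F.alternatingSum = Arveson.eulerChar hH) ∧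
    (∀ n : ℕ, Arveson.IsFiniteRankOp (1 - (Arveson.phi hH)^[n + 1] 1)) ∧
    Tendsto
      (fun n : ℕ => (d.factorial : ℝ) *
        ((Arveson.opRank (1 - (Arveson.phi hH)^[n + 1] 1) : ℝ) / (n : ℝ) ^ d))
      atTop (𝓝 (Arveson.eulerChar hH : ℝ)) := by
  have hΔ : FiniteDimensional ℂ (LinearMap.range (defect hH : H →ₗ[ℂ] H)) := hfin
  obtain ⟨r, b, hb⟩ : ∃ (r : ℕ) (b : Fin r → H),
      Submodule.span ℂ (Set.range b) = LinearMap.range (defect hH : H →ₗ[ℂ] H) :=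
    Submodule.fg_iff_exists_fin_generating_family.1 (Module.Finite.iff_fg.1 hΔ)
  let L := Fintype.linearCombination (PolyAlg d) b
  have hL : LinearMap.range L = algModule hH := range_linearCombination_eq_algModule hH hb
  let π : (Fin r → PolyAlg d) →ₗ[PolyAlg d] algModule hH :=
    L.codRestrict _ fun v => hL ▸ LinearMap.mem_range_self L v
  have hπ : Function.Surjective π := fun x => by
    obtain ⟨v, hv⟩ : x.1 ∈ LinearMap.range L := by
      rw [hL]
      exact x.2
    exact ⟨v, Subtype.ext hv⟩
  have hfg : Module.Finite (PolyAlg d) (algModule hH) := Module.Finite.of_surjective π hπ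
  have hres := FiniteFreeResolution.nonempty_of_finite ℂ d (algModule hH)
  have hχ : eulerChar hH = Module.finrank (PolyAlg d) (algModule hH) :=
    moduleEulerChar_eq_finrank hres
  refine ⟨hres, fun F => by rw [hχ, F.alternatingSum_eq_finrank], fun n => ?_, ?_⟩
  · rw [IsFiniteRankOp, range_one_sub_iterate_phi hH hfin]
    exact finiteDimensional_degreeSpace hH hfin n
  · have hlim := MvPolynomial.tendsto_factorial_mul_finrank_map_div_pow (k := ℂ) π hπ
    rw [hχ, Int.cast_natCast]
    refine hlim.congr fun n => ?_
    -- The Hilbert function lives in $M_H$ and the operator range in $H$; the inclusion is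
    -- injective, so dimensions agree.
    have hrank : opRank (1 - (phi hH)^[n + 1] 1) = Module.finrank ℂ
        ((MvPolynomial.vectorsTotalDegreeLE ℂ d r n).map (π.restrictScalars ℂ)) := by
      rw [opRank, range_one_sub_iterate_phi hH hfin,
        ← map_vectorsTotalDegreeLE_eq_degreeSpace hH hb,
        (Submodule.equivMapOfInjective ((algModule hH).subtype.restrictScalars ℂ)
          Subtype.val_injective _).finrank_eq, ← Submodule.map_comp]
      rfl
    rw [hrank]
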